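/- Conventions. Let $n\ge 1$. Cubes in $\mathbb{R}^n$ are closed, with sides parallel to the axes and positive side length, and $|E|$ is Lebesgue measure. For a cube $Q$, $0<t<1$ and $f$ real-valued and measurable on $Q$, the (maximal) median is $$m_f(t,Q)=\sup\{M\in\mathbb{R}: |\{y\in Q: f(y)<M\}|\le t|Q|\}.$$ For $0<s\le 1/2$, a cube $Q_0$ and $x\in Q_0$, the local sharp maximal function restricted to $Q_0$ is $$M^{\sharp}_{0,s,Q_0}f(x)=\sup_{x\in Q\subset Q_0}\ \inf_{c\in\mathbb{R}}\ \inf\{\alpha\ge 0: |\{y\in Q:|f(y)-c|>\alpha\}|<s|Q|\}\in[0,\infty],$$ the supremum being over cubes $Q$; set $M^{\sharp}_{0,s,Q_0}f=0$ outside $Q_0$. $M^{\sharp}_{0,s}f$ is defined in the same way with $Q_0$ replaced by $\mathbb{R}^n$. For measurable $g:\mathbb{R}^n\to[0,\infty]$, $Mg(x)=\sup_{Q\ni x}\frac1{|Q|}\int_Q g$ (supremum over cubes) is the Hardy–Littlewood maximal function. A weight is a measurable function $w:\mathbb{R}^n\to[0,\infty]$. In $[0,\infty]$, $0\cdot\infty=0$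 and $a^0=1$ for all $a$. Integrals may be infinite. Theorem 2.1. Let $n\ge1$, $0<s<1/2$ and $1/2\le t<1-s$. There is a finite constant $c=c_{n,s,t}$, depending only on $n,s,t$, such that for every $0<\delta\le 1$ and every weight $w$ the following hold. (i) For every cube $Q_0\subset\mathbb{R}^n$ and every real-valued $f$ measurable on $Q_0$, $$\int_{Q_0}|f(x)-m_f(t,Q_0)|\,w(x)\,dx\le c\int_{\mathbb{R}^n}\big(M^{\sharp}_{0,s,Q_0}f(x)\big)^{\delta}\,M\Big(\mathbf 1_{Q_0}\big(M^{\sharp}_{0,s,Q_0}f\big)^{1-\delta}w\Big)(x)\,dx .$$ (ii) If $f$ is real-valued and measurable on $\mathbb{R}^n$ and $m_f(t,Q)\to0$ as $Q\to\mathbb{R}^n$ — it suffices that $m_f(t,Q_k)\to 0$ along one sequence of cubes $Q_k$ such that every point of $\mathbb{R}^n$ lies in $Q_k$ for all large $k$ — then $$\int_{\mathbb{R}^n}|f(x)|\,w(x)\,dx\le c\int_{\mathbb{R}^n}\big(M^{\sharp}_{0,s}f(x)\big)^{\delta}\,M\Big(\big(M^{\sharp}_{0,s}f\big)^{1-\delta}w\Big)(x)\,dx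 .$$ -/

import Mathlib

open MeasureTheory Filter Topology
open scoped ENNReal NNReal

namespace MedianOsc

noncomputable section

/-- Cubes of `ℝⁿ`: closed, with sides parallel to the axes and positive side length `ℓ`. -/
def IsCube {n : ℕ} (Q : Set (Fin n → ℝ)) : Prop :=
  ∃ (a : Fin n → ℝ) (ℓ : ℝ), 0 < ℓ ∧ Q = Set.Icc a (fun i => a i + ℓ)

/-- The (maximal) median `m_f(t, Q) = sup {M : |{y ∈ Q : f y < M}| ≤ t |Q|}`. For a cube `Q`,
`0 < t < 1` and `f` measurable on `Q`, the set on the right is nonempty and bounded above, so that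
this is a genuine supremum. -/
def median {n : ℕ} (f : (Fin n → ℝ) → ℝ) (t : ℝ) (Q : Set (Fin n → ℝ)) : ℝ :=
  sSup {M : ℝ | volume {y | y ∈ Q ∧ f y < M} ≤ ENNReal.ofReal t * volume Q}

/-- `inf_c inf {α ≥ 0 : |{y ∈ Q : |f y - c| > α}| < s |Q|}`, as an element of `[0, ∞]`. -/
def oscillation {n : ℕ} (s : ℝ) (f : (Fin n → ℝ) → ℝ) (Q : Set (Fin n → ℝ)) : ℝ≥0∞ :=
  ⨅ (c : ℝ) (α : ℝ≥0)
    (_ : volume {y | y ∈ Q ∧ (α : ℝ) < |f y - c|} < ENNReal.ofReal s * volume Q), (α : ℝ≥0∞)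

/-- The local sharp maximal function restricted to `U`: the supremum of the oscillations of `f`
over the cubes `Q` with `x ∈ Q ⊆ U`. For a cube `U = Q₀` it is `M^♯_{0,s,Q₀} f`, and it vanishes
outside `Q₀` (empty supremum in `[0, ∞]`); for `U = Set.univ` it is `M^♯_{0,s} f`. -/
def sharpMaximal {n : ℕ} (s : ℝ) (U : Set (Fin n → ℝ)) (f : (Fin n → ℝ) → ℝ)
    (x : Fin n → ℝ) : ℝ≥0∞ :=
  ⨆ (Q : Set (Fin n → ℝ)) (_ : IsCube Q) (_ : x ∈ Q) (_ : Q ⊆ U), oscillation s f Q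

/-- The Hardy–Littlewood maximal function of a nonnegative function: the supremum of its averages
over the cubes that contain `x`. -/
def hlMaximal {n : ℕ} (g : (Fin n → ℝ) → ℝ≥0∞) (x : Fin n → ℝ) : ℝ≥0∞ :=
  ⨆ (Q : Set (Fin n → ℝ)) (_ : IsCube Q) (_ : x ∈ Q), (volume Q)⁻¹ * ∫⁻ y in Q, g y

end

end MedianOsc

/-! The proof is a stopping-time argument on the dyadic subcubes of `Q₀`, driven by two facts about
medians. Since s < 1 - t ≤ t, the function f stays within twice its oscillation over Q of the median
m of Q, off a set of measure at most s|Q| (`volume_oscillation_lt_le`). Conversely, if the median of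
a cube is further than A from r, then |f - r| > A on at least the fraction 1 - t of that cube
(`one_sub_mul_volume_le`).

Given Q, stop at the first dyadic descendants whose median is further than A = 2 osc(Q) from m. By
the two facts they cover at most the fraction s / (1 - t) < 1 of Q. Off them, the medians of all
generations considered stay within A of m. On a stopping cell P, the parent is still within A of m,
and passing from parent to child costs at most 2N times the infimum over P of the sharp maximal
function (`abs_gridMedian_succ_sub_le`).

The error made on Q is thus a multiple of I = inf over Q of the sharp maximal function, weighted by
w(Q). Splitting I = I^δ I^(1-δ) bounds I w(Q) by |Q| times the right-hand integrand at any point of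
Q (`gridInf_mul_lintegral_le`). So it can be charged to the part of Q outside the stopping cells,
which is a fixed fraction of Q. These parts are disjoint as the argument is iterated inside the
stopping cells, so the constant does not grow with the number of generations. Fatou's lemma and the
convergence of dyadic medians to f finish (i); a second use of Fatou along the cubes `Q k` gives
(ii). -/

namespace MedianOsc

/-! ### Medians, oscillations and maximal functions on a single cube -/

section Median

variable {n : ℕ} {f : (Fin n → ℝ) → ℝ} {s t : ℝ} {Q : Set (Fin n → ℝ)}

lemma volume_Icc_side (a : Fin n → ℝ) (ℓ : ℝ) :
    volume (Set.Icc a (fun i => a i + ℓ)) = ENNReal.ofReal ℓ ^ n := by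
  simp [Real.volume_Icc_pi]

lemma IsCube.measurableSet (hQ : IsCube Q) : MeasurableSet Q := by
  obtain ⟨a, ℓ, -, rfl⟩ := hQ
  exact measurableSet_Icc

lemma IsCube.volume_ne_zero (hQ : IsCube Q) : volume Q ≠ 0 := by
  obtain ⟨a, ℓ, h, rfl⟩ := hQ
  rw [volume_Icc_side]
  exact pow_ne_zero _ (by simpa using h)

lemma IsCube.volume_ne_top (hQ : IsCube Q) : volume Q ≠ ⊤ := by
  obtain ⟨a, ℓ, h, rfl⟩ := hQ
  rw [volume_Icc_side]
  exact ENNReal.pow_ne_top ENNReal.ofReal_ne_top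

lemma ofReal_mul_volume_lt (hQ : IsCube Q) {p q : ℝ} (hpq : p < q) (hq : 0 < q) :
    ENNReal.ofReal p * volume Q < ENNReal.ofReal q * volume Q :=
  (ENNReal.mul_lt_mul_iff_left hQ.volume_ne_zero hQ.volume_ne_top).2
    ((ENNReal.ofReal_lt_ofReal_iff hq).2 hpq)

lemma measurableSet_sublevel (hQ : IsCube Q) (hf : Measurable f) (M : ℝ) :
    MeasurableSet {y | y ∈ Q ∧ f y < M} :=
  hQ.measurableSet.inter (measurableSet_lt hf measurable_const)

lemma median_set_nonempty (hQ : IsCube Q) (hf : Measurable f) (ht : 0 < t) :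
    {M : ℝ | volume {y | y ∈ Q ∧ f y < M} ≤ ENNReal.ofReal t * volume Q}.Nonempty := by
  have h : Tendsto (fun k : ℕ => volume {y | y ∈ Q ∧ f y < -(k : ℝ)}) atTop
      (𝓝 (volume (⋂ k : ℕ, {y | y ∈ Q ∧ f y < -(k : ℝ)}))) := by
    refine tendsto_measure_iInter_atTop
      (fun k => (measurableSet_sublevel hQ hf _).nullMeasurableSet) ?_ ⟨0, ?_⟩
    · intro i j hij y hy
      have : (i : ℝ) ≤ j := by exact_mod_cast hij
      exact ⟨hy.1, by have := hy.2; linarith⟩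
    · exact ((measure_mono fun y hy => hy.1).trans_lt hQ.volume_ne_top.lt_top).ne
  have h0 : (⋂ k : ℕ, {y | y ∈ Q ∧ f y < -(k : ℝ)}) = ∅ := by
    ext y
    simp only [Set.mem_iInter, Set.mem_ofPred_eq, Set.mem_empty_iff_false, iff_false, not_forall]
    obtain ⟨k, hk⟩ := exists_nat_gt (-f y)
    exact ⟨k, fun h => by linarith [h.2]⟩
  rw [h0, measure_empty] at h
  have hpos : 0 < ENNReal.ofReal t * volume Q :=
    ENNReal.mul_pos (by simpa using ht) hQ.volume_ne_zero
  obtain ⟨k, hk⟩ := (h.eventually_lt_const hpos).exists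
  exact ⟨_, hk.le⟩

lemma median_set_bddAbove (hQ : IsCube Q) (ht : t < 1) :
    BddAbove {M : ℝ | volume {y | y ∈ Q ∧ f y < M} ≤ ENNReal.ofReal t * volume Q} := by
  have h : Tendsto (fun k : ℕ => volume {y | y ∈ Q ∧ f y < (k : ℝ)}) atTop
      (𝓝 (volume (⋃ k : ℕ, {y | y ∈ Q ∧ f y < (k : ℝ)}))) := by
    refine tendsto_measure_iUnion_atTop ?_
    intro i j hij y hy
    have : (i : ℝ) ≤ j := by exact_mod_cast hij
    exact ⟨hy.1, hy.2.trans_le this⟩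
  have h0 : (⋃ k : ℕ, {y | y ∈ Q ∧ f y < (k : ℝ)}) = Q := by
    ext y
    simp only [Set.mem_iUnion, Set.mem_ofPred_eq]
    exact ⟨fun ⟨k, hk⟩ => hk.1, fun hy => (exists_nat_gt (f y)).imp fun k hk => ⟨hy, hk⟩⟩
  have hlt : ENNReal.ofReal t * volume Q < volume Q := by
    simpa using ofReal_mul_volume_lt hQ ht one_pos
  rw [h0] at h
  obtain ⟨k, hk⟩ := (h.eventually_const_lt hlt).exists
  refine ⟨k, fun M hM => ?_⟩
  by_contra! hlt
  have hsub : {y | y ∈ Q ∧ f y < (k : ℝ)} ⊆ {y | y ∈ Q ∧ f y < M} :=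
    fun y hy => ⟨hy.1, hy.2.trans hlt⟩
  exact absurd (hk.trans_le ((measure_mono hsub).trans hM)) (lt_irrefl _)

/-- Continuity of the measure from below shows that the supremum defining the median is attained. -/
lemma volume_lt_median_le (hQ : IsCube Q) (hf : Measurable f) (ht : 0 < t) :
    volume {y | y ∈ Q ∧ f y < median f t Q} ≤ ENNReal.ofReal t * volume Q := by
  set m := median f t Q with hm
  have h : Tendsto (fun k : ℕ => volume {y | y ∈ Q ∧ f y < m - 1 / ((k : ℝ) + 1)}) atTop
      (𝓝 (volume (⋃ k : ℕ, {y | y ∈ Q ∧ f y < m - 1 / ((k : ℝ) + 1)}))) := by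
    refine tendsto_measure_iUnion_atTop ?_
    intro i j hij y hy
    have : 1 / ((j : ℝ) + 1) ≤ 1 / ((i : ℝ) + 1) := Nat.one_div_le_one_div hij
    exact ⟨hy.1, by have := hy.2; linarith⟩
  have h0 : (⋃ k : ℕ, {y | y ∈ Q ∧ f y < m - 1 / ((k : ℝ) + 1)}) = {y | y ∈ Q ∧ f y < m} := by
    ext y
    simp only [Set.mem_iUnion, Set.mem_ofPred_eq]
    refine ⟨fun ⟨k, hk⟩ => ⟨hk.1, ?_⟩, fun hy => ?_⟩
    · have : 0 < 1 / ((k : ℝ) + 1) := Nat.one_div_pos_of_nat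
      linarith [hk.2]
    · obtain ⟨k, hk⟩ := exists_nat_one_div_lt (sub_pos.2 hy.2)
      exact ⟨k, hy.1, by linarith⟩
  rw [h0] at h
  refine le_of_tendsto h (Eventually.of_forall fun k => ?_)
  have : m - 1 / ((k : ℝ) + 1) < m := by
    have : 0 < 1 / ((k : ℝ) + 1) := Nat.one_div_pos_of_nat
    linarith
  obtain ⟨M, hM, hlt⟩ := exists_lt_of_lt_csSup (median_set_nonempty hQ hf ht) this
  have hsub : {y | y ∈ Q ∧ f y < m - 1 / ((k : ℝ) + 1)} ⊆ {y | y ∈ Q ∧ f y < M} :=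
    fun y hy => ⟨hy.1, hy.2.trans hlt⟩
  exact (measure_mono hsub).trans hM

lemma lt_volume_of_median_lt (hQ : IsCube Q) (ht : t < 1) {M : ℝ} (hM : median f t Q < M) :
    ENNReal.ofReal t * volume Q < volume {y | y ∈ Q ∧ f y < M} := by
  by_contra! h
  exact absurd (le_csSup (median_set_bddAbove hQ ht) h) (not_le.2 hM)

/-- If two sets cover `Q` and one of them has relative measure at most `p`, the other one has
relative measure at least `1 - p`. -/
lemma ofReal_one_sub_mul_le {A B : Set (Fin n → ℝ)} (hQ : volume Q ≠ ⊤) {p : ℝ} (hp : 0 ≤ p)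
    (hAB : Q ⊆ A ∪ B) (hA : volume A ≤ ENNReal.ofReal p * volume Q) :
    ENNReal.ofReal (1 - p) * volume Q ≤ volume B := by
  have h1 : volume Q ≤ ENNReal.ofReal p * volume Q + volume B :=
    (measure_mono hAB).trans ((measure_union_le _ _).trans (by gcongr))
  rw [ENNReal.ofReal_sub _ hp, ENNReal.ofReal_one,
    ENNReal.sub_mul (fun _ _ => hQ), one_mul]
  exact tsub_le_iff_left.2 h1

/-- A median outside [c - α, c + α] would force |f - c| > α on at least the fraction min(t, 1 - t)
of Q, and this minimum exceeds s. -/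
lemma abs_median_sub_le (hQ : IsCube Q) (hf : Measurable f) (hs : 0 < s)
    (ht : 1 / 2 ≤ t) (hst : t < 1 - s) {c : ℝ} {α : ℝ}
    (h : volume {y | y ∈ Q ∧ α < |f y - c|} < ENNReal.ofReal s * volume Q) :
    |median f t Q - c| ≤ α := by
  rw [abs_le]
  constructor
  · by_contra! hlt
    have h1 := lt_volume_of_median_lt (M := c - α) hQ (by linarith) (by linarith : median f t Q < _)
    have h2 : volume {y | y ∈ Q ∧ f y < c - α} ≤ volume {y | y ∈ Q ∧ α < |f y - c|} :=
      measure_mono fun y hy => ⟨hy.1, by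
        rw [abs_sub_comm]
        exact lt_abs.2 (Or.inl (by linarith [hy.2]))⟩
    have h3 : ENNReal.ofReal s * volume Q ≤ ENNReal.ofReal t * volume Q := by
      gcongr; linarith
    exact absurd (h1.trans_le (h2.trans (h.le.trans h3))) (lt_irrefl _)
  · by_contra! hlt
    have h1 := volume_lt_median_le (t := t) hQ hf (by linarith)
    have h2 := ofReal_one_sub_mul_le (B := {y | y ∈ Q ∧ α < |f y - c|}) hQ.volume_ne_top
      (by linarith) ?_ h1
    · have h3 : ENNReal.ofReal s * volume Q ≤ ENNReal.ofReal (1 - t) * volume Q := by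
        gcongr; linarith
      exact absurd (h.trans_le (h3.trans h2)) (lt_irrefl _)
    · intro y hy
      by_cases hyl : f y < median f t Q
      · exact Or.inl ⟨hy, hyl⟩
      · exact Or.inr ⟨hy, lt_abs.2 (Or.inl (by linarith))⟩

/-- For admissible c and α the median is within α of c, so |f - m| > 2α implies |f - c| > α. The
infimum need not be attained: the level is approached from above by ω + 1/(k+1), and the limit turns
the strict bound into ≤. -/
lemma volume_oscillation_lt_le (hQ : IsCube Q) (hf : Measurable f) (hs : 0 < s)
    (ht : 1 / 2 ≤ t) (hst : t < 1 - s) :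
    volume {y | y ∈ Q ∧ 2 * oscillation s f Q < ENNReal.ofReal |f y - median f t Q|} ≤
      ENNReal.ofReal s * volume Q := by
  set ω := oscillation s f Q with hω
  set m := median f t Q with hm
  rcases eq_or_ne ω ⊤ with htop | htop
  · simp [htop]
  have key : ∀ k : ℕ, volume {y | y ∈ Q ∧ 2 * (ω + ((k : ℝ≥0∞) + 1)⁻¹) <
      ENNReal.ofReal |f y - m|} ≤ ENNReal.ofReal s * volume Q := by
    intro k
    have hlt : ω < ω + ((k : ℝ≥0∞) + 1)⁻¹ :=
      ENNReal.lt_add_right htop (by simp [ENNReal.add_eq_top])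
    conv_lhs at hlt => rw [hω, oscillation]
    simp only [iInf_lt_iff] at hlt
    obtain ⟨c, α, h, hα⟩ := hlt
    have hmc := abs_median_sub_le hQ hf hs ht hst h
    refine (measure_mono ?_).trans h.le
    rintro y ⟨hy, hlt⟩
    refine ⟨hy, ?_⟩
    have h2 : ((2 * α : ℝ≥0) : ℝ≥0∞) < ENNReal.ofReal |f y - m| := by
      refine lt_of_le_of_lt ?_ hlt
      push_cast
      gcongr
    rw [ENNReal.ofReal, ENNReal.coe_lt_coe, ← NNReal.coe_lt_coe,
      Real.coe_toNNReal _ (abs_nonneg _)] at h2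
    push_cast at h2
    have := abs_sub_le (f y) c m
    rw [abs_sub_comm c m] at this
    linarith
  have h : Tendsto (fun k : ℕ => volume {y | y ∈ Q ∧ 2 * (ω + ((k : ℝ≥0∞) + 1)⁻¹) <
      ENNReal.ofReal |f y - m|}) atTop
      (𝓝 (volume (⋃ k : ℕ, {y | y ∈ Q ∧ 2 * (ω + ((k : ℝ≥0∞) + 1)⁻¹) <
      ENNReal.ofReal |f y - m|}))) := by
    refine tendsto_measure_iUnion_atTop ?_
    intro i j hij y hy
    refine ⟨hy.1, lt_of_le_of_lt ?_ hy.2⟩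
    gcongr
  refine (measure_mono ?_).trans (le_of_tendsto h (Eventually.of_forall key))
  rintro y ⟨hy, hlt⟩
  simp only [Set.mem_iUnion]
  have hlim : Tendsto (fun k : ℕ => 2 * (ω + ((k : ℝ≥0∞) + 1)⁻¹)) atTop (𝓝 (2 * (ω + 0))) := by
    refine ENNReal.Tendsto.const_mul (tendsto_const_nhds.add ?_) (Or.inr (by simp))
    have := (tendsto_add_atTop_iff_nat 1).2 ENNReal.tendsto_inv_nat_nhds_zero
    simpa using this
  rw [add_zero] at hlim
  obtain ⟨k, hk⟩ := (hlim.eventually_lt_const hlt).exists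
  exact ⟨k, hy, hk⟩

/-- If the median lies above r, the set where f is at least the median serves, of fraction at least
1 - t. If it lies below, {f < r - A} has fraction more than t, and t ≥ 1 - t. -/
lemma one_sub_mul_volume_le (hQ : IsCube Q) (hf : Measurable f)
    (ht : 1 / 2 ≤ t) (ht1 : t < 1) {r : ℝ} {A : ℝ≥0∞}
    (h : A < ENNReal.ofReal |median f t Q - r|) :
    ENNReal.ofReal (1 - t) * volume Q ≤
      volume {y | y ∈ Q ∧ A < ENNReal.ofReal |f y - r|} := by
  rcases le_total r (median f t Q) with hr | hr
  · refine ofReal_one_sub_mul_le hQ.volume_ne_top (by linarith) ?_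
      (volume_lt_median_le hQ hf (by linarith))
    intro y hy
    by_cases hyl : f y < median f t Q
    · exact Or.inl ⟨hy, hyl⟩
    · refine Or.inr ⟨hy, h.trans_le (ENNReal.ofReal_le_ofReal ?_)⟩
      rw [abs_of_nonneg (by linarith), abs_of_nonneg (by linarith)]
      linarith
  · lift A to ℝ≥0 using h.ne_top
    have hA : ∀ x : ℝ, (A : ℝ≥0∞) < ENNReal.ofReal |x| ↔ (A : ℝ) < |x| := fun x => by
      rw [ENNReal.ofReal, ENNReal.coe_lt_coe, ← NNReal.coe_lt_coe,
        Real.coe_toNNReal _ (abs_nonneg _)]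
    rw [hA, abs_of_nonpos (by linarith)] at h
    have h1 := lt_volume_of_median_lt (f := f) (M := r - A) hQ ht1 (by linarith)
    have h2 : ENNReal.ofReal (1 - t) * volume Q ≤ ENNReal.ofReal t * volume Q := by
      gcongr; linarith
    refine h2.trans (h1.le.trans (measure_mono ?_))
    rintro y ⟨hy, hlt⟩
    refine ⟨hy, (hA _).2 ?_⟩
    rw [abs_sub_comm]
    exact lt_abs.2 (Or.inl (by linarith))

/-- Otherwise |f - m'| > 2 osc(Q'), with m' the median of Q', would hold on the fraction 1 - t of Q,
which is too large a part of Q'. The volume condition fails in general for a dyadic child and its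
parent, hence the chains below. -/
lemma abs_median_sub_median_le {Q' : Set (Fin n → ℝ)} (hQ : IsCube Q) (hQ' : IsCube Q')
    (hsub : Q ⊆ Q') (hf : Measurable f) (hs : 0 < s) (ht : 1 / 2 ≤ t) (hst : t < 1 - s)
    (hvol : ENNReal.ofReal s * volume Q' < ENNReal.ofReal (1 - t) * volume Q) :
    ENNReal.ofReal |median f t Q - median f t Q'| ≤ 2 * oscillation s f Q' := by
  by_contra! h
  have h1 := one_sub_mul_volume_le hQ hf ht (by linarith) h
  have h2 := volume_oscillation_lt_le hQ' hf hs ht hst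
  have h3 : {y | y ∈ Q ∧ 2 * oscillation s f Q' < ENNReal.ofReal |f y - median f t Q'|} ⊆
      {y | y ∈ Q' ∧ 2 * oscillation s f Q' < ENNReal.ofReal |f y - median f t Q'|} :=
    fun y hy => ⟨hsub hy.1, hy.2⟩
  exact absurd (hvol.trans_le (h1.trans ((measure_mono h3).trans h2))) (lt_irrefl _)

lemma oscillation_le_sharpMaximal {U : Set (Fin n → ℝ)} {x : Fin n → ℝ} (hQ : IsCube Q)
    (hx : x ∈ Q) (hU : Q ⊆ U) : oscillation s f Q ≤ sharpMaximal s U f x :=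
  le_iSup_of_le Q (le_iSup_of_le hQ (le_iSup_of_le hx (le_iSup_of_le hU le_rfl)))

lemma sharpMaximal_mono {U V : Set (Fin n → ℝ)} (hUV : U ⊆ V) (x : Fin n → ℝ) :
    sharpMaximal s U f x ≤ sharpMaximal s V f x := by
  unfold sharpMaximal
  refine iSup_mono fun Q => iSup_mono fun hQ => iSup_mono fun hx => ?_
  exact iSup_le fun hU => le_iSup_of_le (hU.trans hUV) le_rfl

lemma hlMaximal_mono {g h : (Fin n → ℝ) → ℝ≥0∞} (hgh : ∀ x, g x ≤ h x) (x : Fin n → ℝ) :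
    hlMaximal g x ≤ hlMaximal h x := by
  unfold hlMaximal
  gcongr
  exact hgh _

lemma lintegral_le_volume_mul_hlMaximal (hQ : IsCube Q) (g : (Fin n → ℝ) → ℝ≥0∞)
    {x : Fin n → ℝ} (hx : x ∈ Q) : ∫⁻ y in Q, g y ≤ volume Q * hlMaximal g x := by
  have h : (volume Q)⁻¹ * ∫⁻ y in Q, g y ≤ hlMaximal g x :=
    le_iSup_of_le Q (le_iSup_of_le hQ (le_iSup_of_le hx le_rfl))
  calc ∫⁻ y in Q, g y = volume Q * ((volume Q)⁻¹ * ∫⁻ y in Q, g y) := by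
        rw [← mul_assoc, ENNReal.mul_inv_cancel hQ.volume_ne_zero hQ.volume_ne_top, one_mul]
    _ ≤ _ := by gcongr

lemma median_congr {g : (Fin n → ℝ) → ℝ} (hQ : IsCube Q) (h : f =ᵐ[volume.restrict Q] g) :
    median f t Q = median g t Q := by
  have key : ∀ M : ℝ, volume {y | y ∈ Q ∧ f y < M} = volume {y | y ∈ Q ∧ g y < M} := fun M => by
    refine measure_congr ?_
    filter_upwards [(ae_restrict_iff' hQ.measurableSet).1 h] with y hy
    refine propext (and_congr_right fun hyQ => ?_)
    rw [hy hyQ]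
  simp only [median, key]

lemma oscillation_congr {g : (Fin n → ℝ) → ℝ} (hQ : IsCube Q) (h : f =ᵐ[volume.restrict Q] g) :
    oscillation s f Q = oscillation s g Q := by
  have key : ∀ (c : ℝ) (α : ℝ≥0), volume {y | y ∈ Q ∧ (α : ℝ) < |f y - c|} =
      volume {y | y ∈ Q ∧ (α : ℝ) < |g y - c|} := fun c α => by
    refine measure_congr ?_
    filter_upwards [(ae_restrict_iff' hQ.measurableSet).1 h] with y hy
    refine propext (and_congr_right fun hyQ => ?_)
    rw [hy hyQ]
  simp only [oscillation, key]

lemma sharpMaximal_congr {g : (Fin n → ℝ) → ℝ} {U : Set (Fin n → ℝ)}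
    (h : f =ᵐ[volume.restrict U] g) : sharpMaximal s U f = sharpMaximal s U g := by
  ext x
  unfold sharpMaximal
  refine iSup_congr fun Q => iSup_congr fun hQ => iSup_congr fun _ => iSup_congr fun hU => ?_
  exact oscillation_congr hQ (ae_restrict_of_ae_restrict_of_subset hU h)

end Median

/-! ### Chains of interpolating cubes, sums over fibres, and the dyadic grid -/

section Dyadic

/-- If the sides of `Q'` are twice those of `Q`, then `N` cubes interpolating between `Q'` and `Q`
have consecutive volume ratios at most `(1 + 1 / N) ^ n`. -/
lemma abs_median_sub_median_le_of_chain {n : ℕ} {f : (Fin n → ℝ) → ℝ} {s t : ℝ}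
    (hf : Measurable f) (hs : 0 < s)
    (ht : 1 / 2 ≤ t) (hst : t < 1 - s) {N : ℕ} (hN : 0 < N)
    (hNs : s * (1 + 1 / (N : ℝ)) ^ n < 1 - t) {b b' : Fin n → ℝ} {L : ℝ} (hL : 0 < L)
    (hb : ∀ j, b j ≤ b' j) (hb' : ∀ j, b' j + L / 2 ≤ b j + L) {B : ℝ≥0∞}
    (hB : ∀ Q, IsCube Q → Set.Icc b' (fun j => b' j + L / 2) ⊆ Q →
      Q ⊆ Set.Icc b (fun j => b j + L) → oscillation s f Q ≤ B) :
    ENNReal.ofReal |median f t (Set.Icc b' (fun j => b' j + L / 2)) -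
      median f t (Set.Icc b (fun j => b j + L))| ≤ 2 * N * B := by
  have hN' : (0 : ℝ) < N := by exact_mod_cast hN
  -- The cubes `R r` decrease from the large cube at r = 0 to the small one at r = 1, the corner and
  -- the side being affine in r.
  set R : ℝ → Set (Fin n → ℝ) := fun r =>
    Set.Icc (fun j => (1 - r) * b j + r * b' j)
      (fun j => ((1 - r) * b j + r * b' j) + L * (1 - r / 2)) with hR
  have hR0 : R 0 = Set.Icc b (fun j => b j + L) := by simp [hR]
  have hR1 : R 1 = Set.Icc b' (fun j => b' j + L / 2) := by
    simp only [hR, sub_self, zero_mul, zero_add, one_mul]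
    congr! 3
    ring
  have hanti : ∀ r q : ℝ, r ≤ q → R q ⊆ R r := by
    intro r q hrq
    refine Set.Icc_subset_Icc (fun j => ?_) (fun j => ?_)
    · have := mul_nonneg (sub_nonneg.2 hrq) (sub_nonneg.2 (hb j))
      linarith
    · have := mul_nonneg (sub_nonneg.2 hrq) (sub_nonneg.2 (hb' j))
      linarith
  have hcube : ∀ r : ℝ, r ≤ 1 → IsCube (R r) := fun r hr =>
    ⟨_, _, mul_pos hL (by linarith), rfl⟩
  have hle : ∀ m : ℕ, m ≤ N → ((m : ℝ) / N) ≤ 1 := fun m hm => by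
    rw [div_le_one hN']; exact_mod_cast hm
  have key : ∀ m : ℕ, m ≤ N →
      ENNReal.ofReal |median f t (R (m / N)) - median f t (R 0)| ≤ 2 * m * B := by
    intro m
    induction m with
    | zero => simp
    | succ m ih =>
      intro hm
      have hstep : ENNReal.ofReal |median f t (R ((m + 1 : ℕ) / N)) - median f t (R (m / N))| ≤
          2 * B := by
        have hmono : (m : ℝ) / N ≤ (m + 1 : ℕ) / N := by gcongr; simp
        refine (abs_median_sub_median_le (hcube _ (hle _ hm)) (hcube _ (hle _ (by omega)))
          (hanti _ _ hmono) hf hs ht hst ?_).trans ?_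
        · simp only [hR, volume_Icc_side]
          have hy : 0 < L * (1 - (m + 1 : ℕ) / (N : ℝ) / 2) :=
            mul_pos hL (by linarith [hle _ hm])
          have hx : 0 < L * (1 - m / (N : ℝ) / 2) :=
            mul_pos hL (by linarith [hle m (by omega)])
          rw [← ENNReal.ofReal_pow hy.le, ← ENNReal.ofReal_pow hx.le,
            ← ENNReal.ofReal_mul hs.le, ← ENNReal.ofReal_mul (by linarith),
            ENNReal.ofReal_lt_ofReal_iff (mul_pos (by linarith) (by positivity))]
          -- The ratio of consecutive sides is 1 + 1/(2N - m - 1), and m + 1 ≤ N.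
          have hxy : L * (1 - m / (N : ℝ) / 2) ≤
              (1 + 1 / (N : ℝ)) * (L * (1 - (m + 1 : ℕ) / (N : ℝ) / 2)) := by
            have h1 : (1 + 1 / (N : ℝ)) * (L * (1 - (m + 1 : ℕ) / (N : ℝ) / 2)) -
                L * (1 - m / (N : ℝ) / 2) = L / (2 * N) * (1 - (m + 1 : ℕ) / (N : ℝ)) := by
              push_cast
              field_simp
              ring
            have h2 : 0 ≤ L / (2 * N) * (1 - (m + 1 : ℕ) / (N : ℝ)) :=
              mul_nonneg (by positivity) (by linarith [hle _ hm])
            linarith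
          calc s * (L * (1 - m / (N : ℝ) / 2)) ^ n
              ≤ s * ((1 + 1 / (N : ℝ)) * (L * (1 - (m + 1 : ℕ) / (N : ℝ) / 2))) ^ n := by
                gcongr
            _ = s * (1 + 1 / (N : ℝ)) ^ n * (L * (1 - (m + 1 : ℕ) / (N : ℝ) / 2)) ^ n := by
                rw [mul_pow]; ring
            _ < _ := by gcongr
        · gcongr
          refine hB _ (hcube _ (hle _ (by omega))) ?_ ?_
          · rw [← hR1]; exact hanti _ _ (hle _ (by omega))
          · rw [← hR0]; exact hanti _ _ (by positivity)
      calc ENNReal.ofReal |median f t (R ((m + 1 : ℕ) / N)) - median f t (R 0)|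
          ≤ ENNReal.ofReal (|median f t (R ((m + 1 : ℕ) / N)) - median f t (R (m / N))| +
            |median f t (R (m / N)) - median f t (R 0)|) :=
            ENNReal.ofReal_le_ofReal (abs_sub_le _ _ _)
        _ ≤ 2 * B + 2 * m * B := by
            rw [ENNReal.ofReal_add (abs_nonneg _) (abs_nonneg _)]
            exact add_le_add hstep (ih (by omega))
        _ = 2 * (m + 1 : ℕ) * B := by push_cast; ring
  have := key N le_rfl
  rwa [div_self hN'.ne', hR1, hR0] at this

lemma exists_chain_length (n : ℕ) {s t : ℝ} (hst : t < 1 - s) :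
    ∃ N : ℕ, 0 < N ∧ s * (1 + 1 / (N : ℝ)) ^ n < 1 - t := by
  have h : Tendsto (fun N : ℕ => s * (1 + 1 / (N : ℝ)) ^ n) atTop (𝓝 (s * (1 + 0) ^ n)) :=
    ((tendsto_const_nhds.add tendsto_one_div_atTop_nhds_zero_nat).pow n).const_mul s
  simp only [add_zero, one_pow, mul_one] at h
  exact ((eventually_gt_atTop 0).and (h.eventually_lt_const (by linarith))).exists

lemma measurableSet_of_fiber_subset {α ι : Type*} [MeasurableSpace α] [Countable ι] {π : α → ι}
    (hπ : ∀ i, MeasurableSet (π ⁻¹' {i})) {S : Set α} (hS : ∀ x ∈ S, π ⁻¹' {π x} ⊆ S) :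
    MeasurableSet S := by
  have : S = ⋃ i ∈ π '' S, π ⁻¹' {i} := by
    ext x
    simp only [Set.mem_iUnion, Set.mem_image, exists_prop]
    refine ⟨fun hx => ⟨_, ⟨x, hx, rfl⟩, rfl⟩, ?_⟩
    rintro ⟨-, ⟨y, hy, rfl⟩, hxy⟩
    exact hS y hy hxy
  rw [this]
  exact MeasurableSet.biUnion (Set.to_countable _) fun i _ => hπ i

/-- Summation over countably many disjoint measurable fibres; F and G need not be measurable, so
maximal functions may be inserted. -/
lemma lintegral_le_of_fiber_le {α ι : Type*} [MeasurableSpace α] [Countable ι] {μ : Measure α}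
    {π : α → ι} (hπ : ∀ i, MeasurableSet (π ⁻¹' {i})) {S : Set α}
    (hS : ∀ x ∈ S, π ⁻¹' {π x} ⊆ S) {F G : α → ℝ≥0∞} {C : ℝ≥0∞}
    (h : ∀ x ∈ S, ∫⁻ y in π ⁻¹' {π x}, F y ∂μ ≤ C * ∫⁻ y in π ⁻¹' {π x}, G y ∂μ) :
    ∫⁻ y in S, F y ∂μ ≤ C * ∫⁻ y in S, G y ∂μ := by
  have hSm := measurableSet_of_fiber_subset hπ hS
  have hU : S = ⋃ i, S ∩ π ⁻¹' {i} := by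
    ext x; simp
  have hm : ∀ i, MeasurableSet (S ∩ π ⁻¹' {i}) := fun i => hSm.inter (hπ i)
  have hd : Pairwise (Function.onFun Disjoint fun i => S ∩ π ⁻¹' {i}) := by
    intro i j hij
    refine Set.disjoint_left.2 fun x hx hx' => hij ?_
    exact hx.2.symm.trans hx'.2
  rw [hU, lintegral_iUnion hm hd, lintegral_iUnion hm hd, ← ENNReal.tsum_mul_left]
  refine ENNReal.tsum_le_tsum fun i => ?_
  rcases (S ∩ π ⁻¹' {i}).eq_empty_or_nonempty with he | ⟨x, hx, hxi⟩
  · simp [he]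
  · obtain rfl : π x = i := hxi
    rw [Set.inter_eq_right.2 (hS x hx)]
    exact h x hx

noncomputable section

/-- The index of the dyadic cell of generation `k` that contains `x`, for the grid with origin `a`
and initial side length `ℓ`. -/
def gridIndex {n : ℕ} (a : Fin n → ℝ) (ℓ : ℝ) (k : ℕ) (x : Fin n → ℝ) : Fin n → ℤ :=
  fun j => ⌊(x j - a j) * 2 ^ k / ℓ⌋

/-- The half-open dyadic cell of generation `k` and index `i`. -/
def gridCell {n : ℕ} (a : Fin n → ℝ) (ℓ : ℝ) (k : ℕ) (i : Fin n → ℤ) : Set (Fin n → ℝ) :=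
  gridIndex a ℓ k ⁻¹' {i}

/-- The closed dyadic cube of generation `k` and index `i`. -/
def gridCube {n : ℕ} (a : Fin n → ℝ) (ℓ : ℝ) (k : ℕ) (i : Fin n → ℤ) : Set (Fin n → ℝ) :=
  Set.Icc (fun j => a j + i j * (ℓ / 2 ^ k)) (fun j => a j + i j * (ℓ / 2 ^ k) + ℓ / 2 ^ k)

end

section Grid

variable {n : ℕ} {a : Fin n → ℝ} {ℓ : ℝ}

lemma isCube_gridCube (hℓ : 0 < ℓ) (k : ℕ) (i : Fin n → ℤ) : IsCube (gridCube a ℓ k i) :=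
  ⟨_, _, by positivity, rfl⟩

lemma gridCell_eq_pi (hℓ : 0 < ℓ) (k : ℕ) (i : Fin n → ℤ) :
    gridCell a ℓ k i = Set.univ.pi fun j =>
      Set.Ico (a j + i j * (ℓ / 2 ^ k)) (a j + i j * (ℓ / 2 ^ k) + ℓ / 2 ^ k) := by
  ext x
  simp only [gridCell, Set.mem_preimage, Set.mem_singleton_iff, funext_iff, gridIndex,
    Int.floor_eq_iff, Set.mem_univ_pi, Set.mem_Ico]
  refine forall_congr' fun j => and_congr ?_ ?_
  · rw [le_div_iff₀ hℓ, ← mul_div_assoc, ← le_sub_iff_add_le', div_le_iff₀ (by positivity)]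
  · rw [div_lt_iff₀ hℓ, add_assoc, ← add_one_mul, ← mul_div_assoc, ← sub_lt_iff_lt_add',
      lt_div_iff₀ (by positivity)]

lemma measurableSet_gridCell (hℓ : 0 < ℓ) (k : ℕ) (i : Fin n → ℤ) :
    MeasurableSet (gridCell a ℓ k i) := by
  rw [gridCell_eq_pi hℓ]
  exact MeasurableSet.univ_pi fun j => measurableSet_Ico

lemma gridCell_subset_gridCube (hℓ : 0 < ℓ) (k : ℕ) (i : Fin n → ℤ) :
    gridCell a ℓ k i ⊆ gridCube a ℓ k i := by
  rw [gridCell_eq_pi hℓ, gridCube, ← Set.pi_univ_Icc]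
  exact Set.pi_mono fun j _ => Set.Ico_subset_Icc_self

/-- Half-open cells partition space, while medians and maximal functions use closed cubes; the two
differ by a null set. -/
lemma gridCell_ae_eq_gridCube (hℓ : 0 < ℓ) (k : ℕ) (i : Fin n → ℤ) :
    gridCell a ℓ k i =ᵐ[volume] gridCube a ℓ k i := by
  rw [gridCell_eq_pi hℓ]
  exact Measure.univ_pi_Ico_ae_eq_Icc

lemma mem_gridCell_self (k : ℕ) (x : Fin n → ℝ) : x ∈ gridCell a ℓ k (gridIndex a ℓ k x) := rfl

lemma mem_gridCube_self (hℓ : 0 < ℓ) (k : ℕ) (x : Fin n → ℝ) :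
    x ∈ gridCube a ℓ k (gridIndex a ℓ k x) :=
  gridCell_subset_gridCube hℓ k _ (mem_gridCell_self k x)

lemma gridIndex_eq_succ_div (k : ℕ) (x : Fin n → ℝ) (j : Fin n) :
    gridIndex a ℓ k x j = gridIndex a ℓ (k + 1) x j / 2 := by
  have h := Int.floor_div_natCast ((x j - a j) * 2 ^ (k + 1) / ℓ) 2
  simp only [gridIndex]
  push_cast at h
  rw [← h]
  congr 1
  ring

lemma gridIndex_eq_of_le {j k : ℕ} (hjk : j ≤ k) {x y : Fin n → ℝ}
    (h : gridIndex a ℓ k x = gridIndex a ℓ k y) : gridIndex a ℓ j x = gridIndex a ℓ j y := by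
  induction k, hjk using Nat.le_induction with
  | base => exact h
  | succ k _ ih =>
    refine ih (funext fun i => ?_)
    rw [gridIndex_eq_succ_div k x, gridIndex_eq_succ_div k y, h]

lemma gridIndex_succ_bounds (k : ℕ) (x : Fin n → ℝ) (j : Fin n) :
    2 * (gridIndex a ℓ k x j : ℝ) ≤ gridIndex a ℓ (k + 1) x j ∧
      (gridIndex a ℓ (k + 1) x j : ℝ) ≤ 2 * gridIndex a ℓ k x j + 1 := by
  have h := gridIndex_eq_succ_div (a := a) (ℓ := ℓ) k x j
  constructor
  · have : 2 * gridIndex a ℓ k x j ≤ gridIndex a ℓ (k + 1) x j := by omega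
    exact_mod_cast this
  · have : gridIndex a ℓ (k + 1) x j ≤ 2 * gridIndex a ℓ k x j + 1 := by omega
    exact_mod_cast this

lemma gridCube_succ_corner_le (hℓ : 0 < ℓ) (k : ℕ) (x : Fin n → ℝ) (j : Fin n) :
    a j + gridIndex a ℓ k x j * (ℓ / 2 ^ k) ≤
      a j + gridIndex a ℓ (k + 1) x j * (ℓ / 2 ^ (k + 1)) ∧
    a j + gridIndex a ℓ (k + 1) x j * (ℓ / 2 ^ (k + 1)) + ℓ / 2 ^ k / 2 ≤
      a j + gridIndex a ℓ k x j * (ℓ / 2 ^ k) + ℓ / 2 ^ k := by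
  obtain ⟨h1, h2⟩ := gridIndex_succ_bounds (a := a) (ℓ := ℓ) k x j
  have hL : 0 < ℓ / 2 ^ k / 2 := by positivity
  have e1 : ℓ / 2 ^ (k + 1) = ℓ / 2 ^ k / 2 := by rw [pow_succ]; field_simp
  rw [e1]
  set q := ℓ / 2 ^ k / 2 with hq
  have e2 : ℓ / 2 ^ k = 2 * q := by rw [hq]; ring
  rw [e2]
  constructor
  · have := mul_le_mul_of_nonneg_right h1 hL.le
    linarith
  · have := mul_le_mul_of_nonneg_right h2 hL.le
    linarith

lemma gridCube_succ_eq (k : ℕ) (i : Fin n → ℤ) : gridCube a ℓ (k + 1) i =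
    Set.Icc (fun j => a j + i j * (ℓ / 2 ^ (k + 1)))
      (fun j => a j + i j * (ℓ / 2 ^ (k + 1)) + ℓ / 2 ^ k / 2) := by
  have e1 : ℓ / 2 ^ (k + 1) = ℓ / 2 ^ k / 2 := by rw [pow_succ]; field_simp
  rw [gridCube]
  congr! 3

lemma gridCube_anti (hℓ : 0 < ℓ) {j k : ℕ} (hjk : j ≤ k) (x : Fin n → ℝ) :
    gridCube a ℓ k (gridIndex a ℓ k x) ⊆ gridCube a ℓ j (gridIndex a ℓ j x) := by
  induction k, hjk using Nat.le_induction with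
  | base => exact subset_rfl
  | succ k _ ih =>
    refine subset_trans ?_ ih
    rw [gridCube_succ_eq]
    exact Set.Icc_subset_Icc (fun i => (gridCube_succ_corner_le hℓ k x i).1)
      (fun i => (gridCube_succ_corner_le hℓ k x i).2)

lemma gridCube_zero_zero : gridCube a ℓ 0 0 = Set.Icc a (fun j => a j + ℓ) := by
  simp [gridCube]

end Grid

end Dyadic

/-! ### Dyadic medians: jumps between generations, convergence, and the weighted bound on a cell -/

section GridMedian

noncomputable section

/-- The median of `f` over the closed dyadic cube of generation `k` that contains `x`. -/
def gridMedian {n : ℕ} (f : (Fin n → ℝ) → ℝ) (t : ℝ) (a : Fin n → ℝ) (ℓ : ℝ) (k : ℕ)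
    (x : Fin n → ℝ) : ℝ :=
  median f t (gridCube a ℓ k (gridIndex a ℓ k x))

/-- The infimum of the sharp maximal function over the dyadic cell of generation `k` of `x`. -/
def gridInf {n : ℕ} (s : ℝ) (U : Set (Fin n → ℝ)) (f : (Fin n → ℝ) → ℝ) (a : Fin n → ℝ) (ℓ : ℝ)
    (k : ℕ) (x : Fin n → ℝ) : ℝ≥0∞ :=
  ⨅ y ∈ gridCell a ℓ k (gridIndex a ℓ k x), sharpMaximal s U f y

end

variable {n : ℕ} {a : Fin n → ℝ} {ℓ : ℝ} {f : (Fin n → ℝ) → ℝ} {s t : ℝ} {U : Set (Fin n → ℝ)}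

lemma gridMedian_congr {k : ℕ} {x y : Fin n → ℝ} (h : gridIndex a ℓ k x = gridIndex a ℓ k y) :
    gridMedian f t a ℓ k x = gridMedian f t a ℓ k y := by
  simp only [gridMedian, h]

lemma gridInf_congr {k : ℕ} {x y : Fin n → ℝ} (h : gridIndex a ℓ k x = gridIndex a ℓ k y) :
    gridInf s U f a ℓ k x = gridInf s U f a ℓ k y := by
  simp only [gridInf, h]

lemma oscillation_le_gridInf (hℓ : 0 < ℓ) {k : ℕ} {x : Fin n → ℝ} {Q : Set (Fin n → ℝ)}
    (hQ : IsCube Q) (hsub : gridCube a ℓ k (gridIndex a ℓ k x) ⊆ Q) (hU : Q ⊆ U) :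
    oscillation s f Q ≤ gridInf s U f a ℓ k x :=
  le_iInf₂ fun _ hy =>
    oscillation_le_sharpMaximal hQ (hsub (gridCell_subset_gridCube hℓ _ _ hy)) hU

lemma measurable_gridIndex (hℓ : 0 < ℓ) (k : ℕ) :
    Measurable (gridIndex a ℓ k : (Fin n → ℝ) → Fin n → ℤ) :=
  measurable_to_countable' fun i => measurableSet_gridCell hℓ k i

lemma measurable_gridMedian (hℓ : 0 < ℓ) (k : ℕ) :
    Measurable (gridMedian f t a ℓ k) :=
  (measurable_of_countable fun i => median f t (gridCube a ℓ k i)).comp (measurable_gridIndex hℓ k)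

/-- Every cube of the chain contains the child and lies in the parent, so its oscillation is at most
the sharp maximal function at each point of the child. -/
lemma abs_gridMedian_succ_sub_le (hℓ : 0 < ℓ) (hf : Measurable f) (hs : 0 < s)
    (ht : 1 / 2 ≤ t) (hst : t < 1 - s) {N : ℕ} (hN : 0 < N)
    (hNs : s * (1 + 1 / (N : ℝ)) ^ n < 1 - t) {k : ℕ} {x : Fin n → ℝ}
    (hU : gridCube a ℓ k (gridIndex a ℓ k x) ⊆ U) :
    ENNReal.ofReal |gridMedian f t a ℓ (k + 1) x - gridMedian f t a ℓ k x| ≤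
      2 * N * gridInf s U f a ℓ (k + 1) x := by
  rw [gridMedian, gridMedian, gridCube_succ_eq]
  refine abs_median_sub_median_le_of_chain hf hs ht hst hN hNs (by positivity)
    (fun j => (gridCube_succ_corner_le hℓ k x j).1)
    (fun j => (gridCube_succ_corner_le hℓ k x j).2) fun Q hQ hsub hsub' => ?_
  rw [← gridCube_succ_eq] at hsub
  exact oscillation_le_gridInf hℓ hQ hsub (hsub'.trans hU)

lemma gridCube_eq_closedBall (hℓ : 0 < ℓ) (k : ℕ) (i : Fin n → ℤ) : gridCube a ℓ k i =
    Metric.closedBall (fun j => a j + i j * (ℓ / 2 ^ k) + ℓ / 2 ^ k / 2) (ℓ / 2 ^ k / 2) := by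
  rw [closedBall_pi _ (by positivity), gridCube, ← Set.pi_univ_Icc]
  congr! 2 with j
  rw [Real.closedBall_eq_Icc]
  congr 1 <;> ring

/-- The Lebesgue density theorem along the dyadic cubes that shrink to a point. -/
lemma ae_tendsto_density (hℓ : 0 < ℓ) {S : Set (Fin n → ℝ)} (hS : MeasurableSet S) :
    ∀ᵐ x, x ∈ S → Tendsto (fun k => volume (S ∩ gridCube a ℓ k (gridIndex a ℓ k x)) /
      volume (gridCube a ℓ k (gridIndex a ℓ k x))) atTop (𝓝 1) := by
  rw [← ae_restrict_iff' hS]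
  filter_upwards [IsUnifLocDoublingMeasure.ae_tendsto_measure_inter_div
    (volume : Measure (Fin n → ℝ)) S 1] with x hx
  simp only [gridCube_eq_closedBall hℓ]
  refine hx _ (fun k => ℓ / 2 ^ k / 2) ?_ (Eventually.of_forall fun k => ?_)
  · refine tendsto_nhdsWithin_iff.2 ⟨?_, Eventually.of_forall fun k => ?_⟩
    · have h := (tendsto_pow_atTop_nhds_zero_of_lt_one (r := (1 / 2 : ℝ)) (by norm_num)
        (by norm_num)).const_mul (ℓ / 2)
      rw [mul_zero] at h
      refine h.congr fun k => ?_
      rw [one_div, inv_pow]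
      ring
    · exact Set.mem_Ioi.2 (by positivity)
  · rw [one_mul, ← gridCube_eq_closedBall hℓ]
    exact mem_gridCube_self hℓ k x

lemma eventually_mul_volume_lt (hℓ : 0 < ℓ) {S : Set (Fin n → ℝ)} {x : Fin n → ℝ}
    (h : Tendsto (fun k => volume (S ∩ gridCube a ℓ k (gridIndex a ℓ k x)) /
      volume (gridCube a ℓ k (gridIndex a ℓ k x))) atTop (𝓝 1)) {p : ℝ} (hp : p < 1) :
    ∀ᶠ k in atTop, ENNReal.ofReal p * volume (gridCube a ℓ k (gridIndex a ℓ k x)) <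
      volume (S ∩ gridCube a ℓ k (gridIndex a ℓ k x)) := by
  have hp' : ENNReal.ofReal p < 1 := by simpa using hp
  filter_upwards [h.eventually_const_lt hp'] with k hk
  have hQ := isCube_gridCube (a := a) hℓ k (gridIndex a ℓ k x)
  rwa [ENNReal.lt_div_iff_mul_lt (Or.inl hQ.volume_ne_zero) (Or.inl hQ.volume_ne_top)] at hk

/-- Near a density point of {f > q} or {f < q} that set eventually fills more than the fraction 1 -
t or t of the cube, which puts the median on the correct side of q. Rational levels suffice, so only
countably many null sets are discarded. -/
lemma ae_tendsto_gridMedian (hℓ : 0 < ℓ) (hf : Measurable f) (ht : 0 < t) (ht1 : t < 1) :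
    ∀ᵐ x, Tendsto (fun k => gridMedian f t a ℓ k x) atTop (𝓝 (f x)) := by
  have h1 : ∀ᵐ x, ∀ q : ℚ, x ∈ {y | f y < q} → _ :=
    ae_all_iff.2 fun q : ℚ => ae_tendsto_density (a := a) hℓ
      (measurableSet_lt hf (measurable_const (a := (q : ℝ))))
  have h2 : ∀ᵐ x, ∀ q : ℚ, x ∈ {y | (q : ℝ) < f y} → _ :=
    ae_all_iff.2 fun q : ℚ => ae_tendsto_density (a := a) hℓ
      (measurableSet_lt (measurable_const (a := (q : ℝ))) hf)
  filter_upwards [h1, h2] with x h1 h2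
  refine tendsto_order.2 ⟨fun b hb => ?_, fun b hb => ?_⟩
  · obtain ⟨q, hbq, hq⟩ := exists_rat_btwn hb
    filter_upwards [eventually_mul_volume_lt hℓ (h2 q hq) (sub_lt_self 1 ht)] with k hk
    refine hbq.trans_le ?_
    by_contra! hlt
    have hQ := isCube_gridCube (a := a) hℓ k (gridIndex a ℓ k x)
    have h3 := lt_volume_of_median_lt hQ ht1 hlt
    have hms : MeasurableSet ({y | (q : ℝ) < f y} ∩ gridCube a ℓ k (gridIndex a ℓ k x)) :=
      (measurableSet_lt measurable_const hf).inter hQ.measurableSet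
    have h5 : volume {y | y ∈ gridCube a ℓ k (gridIndex a ℓ k x) ∧ f y < q} +
        volume ({y | (q : ℝ) < f y} ∩ gridCube a ℓ k (gridIndex a ℓ k x)) ≤
        volume (gridCube a ℓ k (gridIndex a ℓ k x)) := by
      rw [← measure_union _ hms]
      · exact measure_mono (Set.union_subset (fun y hy => hy.1) (fun y hy => hy.2))
      · refine Set.disjoint_left.2 fun y hy hy' => ?_
        exact absurd (hy.2.trans hy'.1) (lt_irrefl _)
    have h6 := (ENNReal.add_lt_add h3 hk).trans_le h5
    rw [← add_mul, ← ENNReal.ofReal_add ht.le (by linarith)] at h6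
    simp at h6
  · obtain ⟨q, hq, hbq⟩ := exists_rat_btwn hb
    filter_upwards [eventually_mul_volume_lt hℓ (h1 q hq) ht1] with k hk
    refine lt_of_le_of_lt ?_ hbq
    by_contra! hlt
    have hQ := isCube_gridCube (a := a) hℓ k (gridIndex a ℓ k x)
    have h3 := volume_lt_median_le hQ hf ht
    have h4 : {y | f y < q} ∩ gridCube a ℓ k (gridIndex a ℓ k x) ⊆
        {y | y ∈ gridCube a ℓ k (gridIndex a ℓ k x) ∧
          f y < median f t (gridCube a ℓ k (gridIndex a ℓ k x))} :=
      fun y hy => ⟨hy.2, hy.1.trans hlt⟩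
    exact absurd (hk.trans_le ((measure_mono h4).trans h3)) (lt_irrefl _)

/-- The factor I^(1-δ) goes under the integral, where it is dominated by the sharp maximal function;
I^δ is dominated by its value at y. The point y is arbitrary in the cell, which allows integration
over any part of it. -/
lemma gridInf_mul_lintegral_le (hℓ : 0 < ℓ) {w g : (Fin n → ℝ) → ℝ≥0∞} (hw : AEMeasurable w volume)
    {δ : ℝ} (hδ : 0 < δ) (hδ1 : δ ≤ 1)
    (hg : ∀ y ∈ U, sharpMaximal s U f y ^ (1 - δ) * w y ≤ g y) {k : ℕ} {x : Fin n → ℝ}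
    (hU : gridCube a ℓ k (gridIndex a ℓ k x) ⊆ U) {y : Fin n → ℝ}
    (hy : y ∈ gridCell a ℓ k (gridIndex a ℓ k x)) :
    gridInf s U f a ℓ k x * ∫⁻ z in gridCell a ℓ k (gridIndex a ℓ k x), w z ≤
      volume (gridCell a ℓ k (gridIndex a ℓ k x)) *
        (sharpMaximal s U f y ^ δ * hlMaximal g y) := by
  have hQ := isCube_gridCube (a := a) hℓ k (gridIndex a ℓ k x)
  have hsub := gridCell_subset_gridCube (a := a) hℓ k (gridIndex a ℓ k x)
  set I := gridInf s U f a ℓ k x with hI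
  have hIle : ∀ z ∈ gridCell a ℓ k (gridIndex a ℓ k x), I ≤ sharpMaximal s U f z :=
    fun z hz => iInf₂_le z hz
  have h1 : I = I ^ δ * I ^ (1 - δ) := by
    rw [← ENNReal.rpow_add_of_nonneg _ _ hδ.le (by linarith)]
    simp
  calc I * ∫⁻ z in gridCell a ℓ k (gridIndex a ℓ k x), w z
      = I ^ δ * ∫⁻ z in gridCell a ℓ k (gridIndex a ℓ k x), I ^ (1 - δ) * w z := by
        rw [lintegral_const_mul'' _ hw.restrict, ← mul_assoc, ← h1]
    _ ≤ I ^ δ * ∫⁻ z in gridCube a ℓ k (gridIndex a ℓ k x), g z := by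
        gcongr I ^ δ * ?_
        refine (setLIntegral_mono' (measurableSet_gridCell hℓ _ _) fun z hz => ?_).trans
          (lintegral_mono_set hsub)
        refine le_trans ?_ (hg z (hU (hsub hz)))
        gcongr
        exact hIle z hz
    _ ≤ sharpMaximal s U f y ^ δ *
        (volume (gridCube a ℓ k (gridIndex a ℓ k x)) * hlMaximal g y) := by
        gcongr
        · exact hIle y hy
        · exact lintegral_le_volume_mul_hlMaximal hQ g (hsub hy)
    _ = _ := by
        rw [measure_congr (gridCell_ae_eq_gridCube hℓ k _)]
        ring

end GridMedian

/-! ### Stopping cells and the inductive weighted estimate -/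

section Stopping

variable {n : ℕ} {a : Fin n → ℝ} {ℓ : ℝ} {f : (Fin n → ℝ) → ℝ} {s t : ℝ} {U : Set (Fin n → ℝ)}

/-- The points of `Q` whose dyadic medians first deviate from `m` by more than `A` at generation
`j`, counting from generation `k + 1`. -/
def stoppingSet (f : (Fin n → ℝ) → ℝ) (t : ℝ) (a : Fin n → ℝ) (ℓ : ℝ) (Q : Set (Fin n → ℝ))
    (m : ℝ) (A : ℝ≥0∞) (k j : ℕ) : Set (Fin n → ℝ) :=
  {x | x ∈ Q ∧ A < ENNReal.ofReal |gridMedian f t a ℓ j x - m| ∧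
    ∀ i, k < i → i < j → ENNReal.ofReal |gridMedian f t a ℓ i x - m| ≤ A}

lemma gridCell_subset_stoppingSet {k j : ℕ} (hkj : k < j) {i₀ : Fin n → ℤ} {m : ℝ} {A : ℝ≥0∞} :
    ∀ x ∈ stoppingSet f t a ℓ (gridCell a ℓ k i₀) m A k j,
      gridIndex a ℓ j ⁻¹' {gridIndex a ℓ j x} ⊆
        stoppingSet f t a ℓ (gridCell a ℓ k i₀) m A k j := by
  rintro x ⟨hx, hbad, hgood⟩ y hy
  have hy' : gridIndex a ℓ j y = gridIndex a ℓ j x := hy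
  refine ⟨(gridIndex_eq_of_le hkj.le hy').trans hx, ?_, fun i hki hij => ?_⟩
  · rwa [gridMedian_congr hy']
  · rw [gridMedian_congr (gridIndex_eq_of_le hij.le hy')]
    exact hgood i hki hij

lemma measurableSet_stoppingSet (hℓ : 0 < ℓ) {k j : ℕ} (hkj : k < j) {i₀ : Fin n → ℤ} {m : ℝ}
    {A : ℝ≥0∞} : MeasurableSet (stoppingSet f t a ℓ (gridCell a ℓ k i₀) m A k j) :=
  measurableSet_of_fiber_subset (fun i => measurableSet_gridCell hℓ j i)
    (gridCell_subset_stoppingSet hkj)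

lemma pairwiseDisjoint_stoppingSet {Q : Set (Fin n → ℝ)} {k K : ℕ} {m : ℝ} {A : ℝ≥0∞} :
    (↑(Finset.Ioc k K) : Set ℕ).PairwiseDisjoint (stoppingSet f t a ℓ Q m A k) := by
  have key : ∀ i j, k < i → i < j →
      Disjoint (stoppingSet f t a ℓ Q m A k i) (stoppingSet f t a ℓ Q m A k j) :=
    fun i j hki hij => Set.disjoint_left.2 fun x hx hx' =>
      absurd hx.2.1 (not_lt.2 (hx'.2.2 i hki hij))
  intro i hi j hj hij
  rcases lt_or_gt_of_ne hij with h | h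
  · exact key i j (Finset.mem_Ioc.1 hi).1 h
  · exact (key j i (Finset.mem_Ioc.1 hj).1 h).symm

/-- The stopping cells inside a cell `Q` cover at most the fraction `s / (1 - t)` of `Q`. -/
lemma volume_stopping_le (hℓ : 0 < ℓ) (hf : Measurable f) (hs : 0 < s) (ht : 1 / 2 ≤ t)
    (hst : t < 1 - s) {k K : ℕ} {i₀ : Fin n → ℤ} {m : ℝ} {A : ℝ≥0∞}
    (hm : m = median f t (gridCube a ℓ k i₀)) (hA : A = 2 * oscillation s f (gridCube a ℓ k i₀)) :
    ENNReal.ofReal (1 - t) * volume (⋃ j ∈ Finset.Ioc k K,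
        stoppingSet f t a ℓ (gridCell a ℓ k i₀) m A k j) ≤
      ENNReal.ofReal s * volume (gridCell a ℓ k i₀) := by
  have hQ := isCube_gridCube (a := a) hℓ k i₀
  set E : Set (Fin n → ℝ) := {y | A < ENNReal.ofReal |f y - m|} with hE
  have hEm : MeasurableSet E :=
    measurableSet_lt measurable_const (hf.sub_const m).abs.ennreal_ofReal
  set S := stoppingSet f t a ℓ (gridCell a ℓ k i₀) m A k with hS
  have hSm : ∀ j ∈ Finset.Ioc k K, MeasurableSet (S j) := fun j hj =>
    measurableSet_stoppingSet hℓ (Finset.mem_Ioc.1 hj).1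
  have hSE : ∀ j ∈ Finset.Ioc k K, ENNReal.ofReal (1 - t) * volume (S j) ≤ volume (E ∩ S j) := by
    intro j hj
    have hkj := (Finset.mem_Ioc.1 hj).1
    -- The fractional bound holds on each stopping cell of generation j; integrating a constant
    -- against the indicator of E adds these bounds up.
    have h := lintegral_le_of_fiber_le (μ := volume) (fun i => measurableSet_gridCell hℓ j i)
      (gridCell_subset_stoppingSet hkj) (S := S j) (F := fun _ => ENNReal.ofReal (1 - t))
      (G := E.indicator 1) (C := 1) ?_
    · simpa [lintegral_indicator_one hEm, Measure.restrict_apply hEm] using h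
    · intro x hx
      have hQx := isCube_gridCube (a := a) hℓ j (gridIndex a ℓ j x)
      have hae := gridCell_ae_eq_gridCube (a := a) hℓ j (gridIndex a ℓ j x)
      have h1 := one_sub_mul_volume_le hQx hf ht (by linarith) hx.2.1
      rw [setLIntegral_const, lintegral_indicator_one hEm, Measure.restrict_apply hEm, one_mul]
      have h2 : volume (E ∩ gridIndex a ℓ j ⁻¹' {gridIndex a ℓ j x}) =
          volume (E ∩ gridCube a ℓ j (gridIndex a ℓ j x)) :=
        measure_congr ((ae_eq_refl E).inter hae)
      have h3 : volume (gridIndex a ℓ j ⁻¹' {gridIndex a ℓ j x}) =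
          volume (gridCube a ℓ j (gridIndex a ℓ j x)) := measure_congr hae
      rw [h2, h3]
      refine h1.trans (measure_mono fun y hy => ⟨hy.2, hy.1⟩)
  have hd := pairwiseDisjoint_stoppingSet (f := f) (t := t) (a := a) (ℓ := ℓ)
    (Q := gridCell a ℓ k i₀) (k := k) (K := K) (m := m) (A := A)
  calc ENNReal.ofReal (1 - t) * volume (⋃ j ∈ Finset.Ioc k K, S j)
      = ∑ j ∈ Finset.Ioc k K, ENNReal.ofReal (1 - t) * volume (S j) := by
        rw [measure_biUnion_finset hd hSm, Finset.mul_sum]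
    _ ≤ ∑ j ∈ Finset.Ioc k K, volume (E ∩ S j) := Finset.sum_le_sum hSE
    _ = volume (⋃ j ∈ Finset.Ioc k K, E ∩ S j) :=
        (measure_biUnion_finset (hd.mono_on fun j _ => Set.inter_subset_right)
          fun j hj => hEm.inter (hSm j hj)).symm
    _ ≤ volume {y | y ∈ gridCube a ℓ k i₀ ∧ A < ENNReal.ofReal |f y - m|} := by
        refine measure_mono (Set.iUnion₂_subset fun j _ y hy => ⟨?_, hy.1⟩)
        exact gridCell_subset_gridCube hℓ k i₀ hy.2.1
    _ ≤ ENNReal.ofReal s * volume (gridCube a ℓ k i₀) := by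
        rw [hA, hm]
        exact volume_oscillation_lt_le hQ hf hs ht hst
    _ = _ := by rw [measure_congr (gridCell_ae_eq_gridCube hℓ k i₀)]

lemma volume_diff_stopping_ge (hℓ : 0 < ℓ) (hf : Measurable f) (hs : 0 < s) (ht : 1 / 2 ≤ t)
    (hst : t < 1 - s) {k K : ℕ} {i₀ : Fin n → ℤ} {m : ℝ} {A : ℝ≥0∞}
    (hm : m = median f t (gridCube a ℓ k i₀)) (hA : A = 2 * oscillation s f (gridCube a ℓ k i₀)) :
    ENNReal.ofReal (1 - s / (1 - t)) * volume (gridCell a ℓ k i₀) ≤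
      volume (gridCell a ℓ k i₀ \ ⋃ j ∈ Finset.Ioc k K,
        stoppingSet f t a ℓ (gridCell a ℓ k i₀) m A k j) := by
  have h := volume_stopping_le (K := K) hℓ hf hs ht hst hm hA
  have ht1 : 0 < 1 - t := by linarith
  have hfin : volume (gridCell a ℓ k i₀) ≠ ⊤ := by
    rw [measure_congr (gridCell_ae_eq_gridCube hℓ k i₀)]
    exact (isCube_gridCube hℓ k i₀).volume_ne_top
  refine ofReal_one_sub_mul_le hfin (by positivity)
    (by rw [Set.union_sdiff_self]; exact Set.subset_union_right) ?_
  rw [ENNReal.ofReal_div_of_pos ht1, div_eq_mul_inv, mul_right_comm, ← div_eq_mul_inv,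
    ENNReal.le_div_iff_mul_le (Or.inl (by simpa using ht1)) (Or.inl ENNReal.ofReal_ne_top),
    mul_comm]
  exact h

/-- The integrand of the inductive estimate: the deviation of the medians of generation `K` from
those of generation `k`, together with the error of passing to generation `k`. -/
noncomputable def gridDeviation (s t : ℝ) (U : Set (Fin n → ℝ)) (f : (Fin n → ℝ) → ℝ)
    (a : Fin n → ℝ) (ℓ : ℝ) (N K k : ℕ) (x : Fin n → ℝ) : ℝ≥0∞ :=
  ENNReal.ofReal |gridMedian f t a ℓ K x - gridMedian f t a ℓ k x| +
    2 * N * gridInf s U f a ℓ k x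

/-- The constant of the weighted estimate. -/
noncomputable def deviationConst (s t : ℝ) (N : ℕ) : ℝ≥0∞ :=
  (2 + 2 * N) * (ENNReal.ofReal (1 - s / (1 - t)))⁻¹

/-- A point in no stopping cell has, by induction on the generation, all its medians up to
generation K within A of the starting one. -/
lemma gridDeviation_le_of_not_mem {N K k : ℕ} (hkK : k ≤ K) {x₀ x : Fin n → ℝ} {A : ℝ≥0∞}
    (hx : x ∈ gridCell a ℓ k (gridIndex a ℓ k x₀))
    (hS : ∀ j ∈ Finset.Ioc k K, x ∉ stoppingSet f t a ℓ (gridCell a ℓ k (gridIndex a ℓ k x₀))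
      (gridMedian f t a ℓ k x₀) A k j) :
    gridDeviation s t U f a ℓ N K k x ≤ A + 2 * N * gridInf s U f a ℓ k x₀ := by
  rw [gridDeviation, gridMedian_congr (k := k) hx, gridInf_congr hx]
  gcongr
  have key : ∀ j, k < j → j ≤ K →
      ENNReal.ofReal |gridMedian f t a ℓ j x - gridMedian f t a ℓ k x₀| ≤ A := by
    intro j
    induction j using Nat.strong_induction_on with
    | _ j ih =>
      intro hkj hjK
      by_contra! hlt
      exact hS j (Finset.mem_Ioc.2 ⟨hkj, hjK⟩)
        ⟨hx, hlt, fun i hki hij => ih i hij hki (by omega)⟩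
  rcases hkK.eq_or_lt with rfl | hlt
  · rw [gridMedian_congr hx]; simp
  · exact key K hlt le_rfl

/-- The parent of a stopping cell is the starting cell or was not stopped, so its median is within
A. The jump to the child is absorbed by the second term of `gridDeviation` at generation j. -/
lemma gridDeviation_le_of_mem (hℓ : 0 < ℓ) (hf : Measurable f) (hs : 0 < s)
    (ht : 1 / 2 ≤ t) (hst : t < 1 - s) {N : ℕ} (hN : 0 < N)
    (hNs : s * (1 + 1 / (N : ℝ)) ^ n < 1 - t) {K k j : ℕ} (hkj : k < j)
    {x₀ x : Fin n → ℝ} {A : ℝ≥0∞} (hU : gridCube a ℓ k (gridIndex a ℓ k x₀) ⊆ U)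
    (hx : x ∈ stoppingSet f t a ℓ (gridCell a ℓ k (gridIndex a ℓ k x₀))
      (gridMedian f t a ℓ k x₀) A k j) :
    gridDeviation s t U f a ℓ N K k x ≤
      (A + 2 * N * gridInf s U f a ℓ k x₀) + gridDeviation s t U f a ℓ N K j x := by
  obtain ⟨hxQ, -, hgood⟩ := hx
  obtain ⟨i, rfl⟩ : ∃ i, j = i + 1 := ⟨j - 1, by omega⟩
  have hki : k ≤ i := by omega
  rw [gridDeviation, gridDeviation, gridMedian_congr (k := k) hxQ, gridInf_congr (k := k) hxQ]
  have hparent : ENNReal.ofReal |gridMedian f t a ℓ i x - gridMedian f t a ℓ k x₀| ≤ A := by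
    rcases hki.eq_or_lt with rfl | hlt
    · rw [gridMedian_congr hxQ]; simp
    · exact hgood i hlt (by omega)
  have hxQ' : gridIndex a ℓ k x = gridIndex a ℓ k x₀ := hxQ
  have hstep := abs_gridMedian_succ_sub_le (U := U) (x := x) hℓ hf hs ht hst hN hNs (k := i)
    ((gridCube_anti hℓ hki x).trans (hxQ' ▸ hU))
  set mK := gridMedian f t a ℓ K x
  set mj := gridMedian f t a ℓ (i + 1) x
  set mi := gridMedian f t a ℓ i x
  set m := gridMedian f t a ℓ k x₀
  have htri : ENNReal.ofReal |mK - m| ≤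
      ENNReal.ofReal |mK - mj| + (ENNReal.ofReal |mj - mi| + ENNReal.ofReal |mi - m|) := by
    rw [← ENNReal.ofReal_add (abs_nonneg _) (abs_nonneg _),
      ← ENNReal.ofReal_add (abs_nonneg _) (by positivity)]
    refine ENNReal.ofReal_le_ofReal ((abs_sub_le _ mj _).trans ?_)
    gcongr
    exact abs_sub_le _ _ _
  calc ENNReal.ofReal |mK - m| + 2 * N * gridInf s U f a ℓ k x₀
      ≤ (ENNReal.ofReal |mK - mj| + (2 * N * gridInf s U f a ℓ (i + 1) x + A)) +
        2 * N * gridInf s U f a ℓ k x₀ := by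
        gcongr
        exact htri.trans (by gcongr)
    _ = _ := by ring

/-- The weighted estimate for finitely many generations, by induction on their number. -/
lemma lintegral_gridDeviation_mul_le (hℓ : 0 < ℓ) (hf : Measurable f) (hs : 0 < s)
    (ht : 1 / 2 ≤ t) (hst : t < 1 - s) {N : ℕ} (hN : 0 < N)
    (hNs : s * (1 + 1 / (N : ℝ)) ^ n < 1 - t) {w g : (Fin n → ℝ) → ℝ≥0∞}
    (hw : AEMeasurable w volume) {δ : ℝ} (hδ : 0 < δ) (hδ1 : δ ≤ 1)
    (hg : ∀ y ∈ U, sharpMaximal s U f y ^ (1 - δ) * w y ≤ g y) (K : ℕ) :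
    ∀ d k, k + d = K → ∀ x₀, gridCube a ℓ k (gridIndex a ℓ k x₀) ⊆ U →
      ∫⁻ x in gridCell a ℓ k (gridIndex a ℓ k x₀), gridDeviation s t U f a ℓ N K k x * w x ≤
        deviationConst s t N * ∫⁻ x in gridCell a ℓ k (gridIndex a ℓ k x₀),
          sharpMaximal s U f x ^ δ * hlMaximal g x := by
  intro d
  -- Here d = K - k is the number of generations left; when d = 0 there are no stopping cells.
  induction d using Nat.strong_induction_on with
  | _ d ih =>
  intro k hkd x₀ hU
  set Q := gridCell a ℓ k (gridIndex a ℓ k x₀) with hQdef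
  set G : (Fin n → ℝ) → ℝ≥0∞ := fun x => sharpMaximal s U f x ^ δ * hlMaximal g x with hG
  set A := 2 * oscillation s f (gridCube a ℓ k (gridIndex a ℓ k x₀)) with hA
  set m := gridMedian f t a ℓ k x₀ with hm
  set I := gridInf s U f a ℓ k x₀ with hI
  set c := deviationConst s t N with hc
  set S := stoppingSet f t a ℓ Q m A k with hS
  set SS := ⋃ j ∈ Finset.Ioc k K, S j with hSS
  have hQm : MeasurableSet Q := measurableSet_gridCell hℓ _ _
  have hQfin : volume Q ≠ ⊤ := by
    rw [hQdef, measure_congr (gridCell_ae_eq_gridCube hℓ k _)]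
    exact (isCube_gridCube hℓ k _).volume_ne_top
  have hQpos : volume Q ≠ 0 := by
    rw [hQdef, measure_congr (gridCell_ae_eq_gridCube hℓ k _)]
    exact (isCube_gridCube hℓ k _).volume_ne_zero
  have hSm : ∀ j ∈ Finset.Ioc k K, MeasurableSet (S j) := fun j hj =>
    measurableSet_stoppingSet hℓ (Finset.mem_Ioc.1 hj).1
  have hSSm : MeasurableSet SS := Finset.measurableSet_biUnion _ hSm
  have hd : (↑(Finset.Ioc k K) : Set ℕ).PairwiseDisjoint S := pairwiseDisjoint_stoppingSet
  have hSSQ : SS ⊆ Q := Set.iUnion₂_subset fun j _ x hx => hx.1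
  have hsplit : ∀ F : (Fin n → ℝ) → ℝ≥0∞, ∫⁻ x in Q, F x =
      (∑ j ∈ Finset.Ioc k K, ∫⁻ x in S j, F x) + ∫⁻ x in Q \ SS, F x := fun F => by
    rw [← lintegral_biUnion_finset hd hSm, ← lintegral_inter_add_sdiff F Q hSSm,
      Set.inter_eq_right.2 hSSQ]
  -- the part of the integral over the complement of the stopping cells
  have hgoodpart : ∫⁻ x in Q \ SS, gridDeviation s t U f a ℓ N K k x * w x ≤
      (A + 2 * N * I) * ∫⁻ x in Q \ SS, w x := by
    rw [← lintegral_const_mul'' _ hw.restrict]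
    refine setLIntegral_mono' (hQm.diff hSSm) fun x hx => ?_
    gcongr
    refine gridDeviation_le_of_not_mem (by omega) hx.1 fun j hj hxj => hx.2 ?_
    exact Set.mem_biUnion (Finset.mem_coe.2 hj) hxj
  -- the part over the stopping cells of a fixed generation
  have hbadpart : ∀ j ∈ Finset.Ioc k K, ∫⁻ x in S j, gridDeviation s t U f a ℓ N K k x * w x ≤
      (A + 2 * N * I) * (∫⁻ x in S j, w x) + c * ∫⁻ x in S j, G x := by
    intro j hj
    obtain ⟨hkj, hjK⟩ := Finset.mem_Ioc.1 hj
    have hfib : ∫⁻ x in S j, gridDeviation s t U f a ℓ N K j x * w x ≤ c * ∫⁻ x in S j, G x := by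
      refine lintegral_le_of_fiber_le (fun i => measurableSet_gridCell hℓ j i)
        (gridCell_subset_stoppingSet hkj) fun x hx => ?_
      refine ih (K - j) (by omega) j (by omega) x ?_
      have hx' : gridIndex a ℓ k x = gridIndex a ℓ k x₀ := hx.1
      exact (gridCube_anti hℓ hkj.le x).trans (hx' ▸ hU)
    calc ∫⁻ x in S j, gridDeviation s t U f a ℓ N K k x * w x
        ≤ ∫⁻ x in S j, ((A + 2 * N * I) * w x + gridDeviation s t U f a ℓ N K j x * w x) := by
          refine setLIntegral_mono' (hSm j hj) fun x hx => ?_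
          rw [← add_mul]
          gcongr
          exact gridDeviation_le_of_mem hℓ hf hs ht hst hN hNs hkj hU hx
      _ = (A + 2 * N * I) * (∫⁻ x in S j, w x) +
          ∫⁻ x in S j, gridDeviation s t U f a ℓ N K j x * w x := by
          rw [lintegral_add_left' (hw.restrict.const_mul _), lintegral_const_mul'' _ hw.restrict]
      _ ≤ _ := by gcongr
  -- the common error term is charged to the complement of the stopping cells
  have hcharge : (A + 2 * N * I) * ∫⁻ x in Q, w x ≤ c * ∫⁻ x in Q \ SS, G x := by
    set V := I * ∫⁻ x in Q, w x with hV
    have hAI : A ≤ 2 * I := by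
      rw [hA]
      gcongr
      exact oscillation_le_gridInf hℓ (isCube_gridCube hℓ _ _) subset_rfl hU
    have hκ : 0 < 1 - s / (1 - t) := by
      rw [sub_pos, div_lt_one (by linarith)]
      linarith
    set κ := ENNReal.ofReal (1 - s / (1 - t)) with hκdef
    have hκ0 : κ ≠ 0 := by simpa [hκdef] using hκ
    have hvol : κ * volume Q ≤ volume (Q \ SS) := volume_diff_stopping_ge hℓ hf hs ht hst rfl rfl
    have h1 : V * volume (Q \ SS) ≤ volume Q * ∫⁻ x in Q \ SS, G x := by
      rw [← setLIntegral_const, ← lintegral_const_mul' _ _ hQfin]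
      exact setLIntegral_mono' (hQm.diff hSSm) fun x hx =>
        gridInf_mul_lintegral_le hℓ hw hδ hδ1 hg hU hx.1
    have h2 : volume Q * (κ * V) ≤ volume Q * ∫⁻ x in Q \ SS, G x := by
      calc volume Q * (κ * V) = V * (κ * volume Q) := by ring
        _ ≤ V * volume (Q \ SS) := by gcongr
        _ ≤ _ := h1
    have h3 : κ * V ≤ ∫⁻ x in Q \ SS, G x := (ENNReal.mul_le_mul_iff_right hQpos hQfin).1 h2
    calc (A + 2 * N * I) * ∫⁻ x in Q, w x ≤ (2 * I + 2 * N * I) * ∫⁻ x in Q, w x := by gcongr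
      _ = (2 + 2 * N) * (κ⁻¹ * (κ * V)) := by
          rw [← mul_assoc κ⁻¹, ENNReal.inv_mul_cancel hκ0 ENNReal.ofReal_ne_top, hV]
          ring
      _ ≤ (2 + 2 * N) * (κ⁻¹ * ∫⁻ x in Q \ SS, G x) := by gcongr
      _ = c * ∫⁻ x in Q \ SS, G x := by rw [hc, deviationConst, mul_assoc]
  -- The complement pays for the error on all of Q and the stopping cells pay for themselves; as
  -- they are disjoint, the same constant `c` returns.
  calc ∫⁻ x in Q, gridDeviation s t U f a ℓ N K k x * w x
      ≤ (∑ j ∈ Finset.Ioc k K,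
          ((A + 2 * N * I) * (∫⁻ x in S j, w x) + c * ∫⁻ x in S j, G x)) +
          (A + 2 * N * I) * ∫⁻ x in Q \ SS, w x := by
        rw [hsplit]
        exact add_le_add (Finset.sum_le_sum hbadpart) hgoodpart
    _ = (A + 2 * N * I) * (∫⁻ x in Q, w x) + c * ∑ j ∈ Finset.Ioc k K, ∫⁻ x in S j, G x := by
        rw [hsplit w, Finset.sum_add_distrib, ← Finset.mul_sum, ← Finset.mul_sum]
        ring
    _ ≤ c * (∫⁻ x in Q \ SS, G x) + c * ∑ j ∈ Finset.Ioc k K, ∫⁻ x in S j, G x := by gcongr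
    _ = c * ∫⁻ x in Q, G x := by rw [hsplit G]; ring

end Stopping

/-! ### Passage to the limit and removal of the measurability assumption -/

section Weighted

/-- Fatou's lemma for a weighted pointwise limit, with a weight that may take the value `∞`. -/
lemma lintegral_mul_le_of_tendsto {α : Type*} [MeasurableSpace α] {μ : Measure α}
    {u : ℕ → α → ℝ≥0∞} {v w : α → ℝ≥0∞} (hu : ∀ k, AEMeasurable (u k) μ) (hw : AEMeasurable w μ)
    (hlim : ∀ᵐ x ∂μ, Tendsto (fun k => u k x) atTop (𝓝 (v x))) {B : ℝ≥0∞}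
    (hB : ∀ k, ∫⁻ x, u k x * w x ∂μ ≤ B) : ∫⁻ x, v x * w x ∂μ ≤ B := by
  calc ∫⁻ x, v x * w x ∂μ ≤ ∫⁻ x, liminf (fun k => u k x * w x) atTop ∂μ := by
        refine lintegral_mono_ae ?_
        filter_upwards [hlim] with x hx
        -- Multiplication by w x = ∞ is discontinuous only at 0, and there the left side is 0
        -- because 0 · ∞ = 0.
        rcases eq_or_ne (v x) 0 with h0 | h0
        · simp [h0]
        · exact (ENNReal.Tendsto.mul_const hx (Or.inl h0)).liminf_eq.ge
    _ ≤ liminf (fun k => ∫⁻ x, u k x * w x ∂μ) atTop :=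
        lintegral_liminf_le' fun k => (hu k).mul hw
    _ ≤ B := liminf_le_of_le (by isBoundedDefault) fun b hb => by
        obtain ⟨k, hk⟩ := hb.exists
        exact hk.trans (hB k)

variable {n : ℕ} {f : (Fin n → ℝ) → ℝ} {s t : ℝ}

lemma lintegral_abs_sub_median_mul_le_of_measurable {Q₀ : Set (Fin n → ℝ)} (hQ₀ : IsCube Q₀)
    (hf : Measurable f) (hs : 0 < s) (ht : 1 / 2 ≤ t) (hst : t < 1 - s) {N : ℕ} (hN : 0 < N)
    (hNs : s * (1 + 1 / (N : ℝ)) ^ n < 1 - t) {w g : (Fin n → ℝ) → ℝ≥0∞}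
    (hw : AEMeasurable w volume) {δ : ℝ} (hδ : 0 < δ) (hδ1 : δ ≤ 1)
    (hg : ∀ y ∈ Q₀, sharpMaximal s Q₀ f y ^ (1 - δ) * w y ≤ g y) :
    ∫⁻ x in Q₀, ENNReal.ofReal |f x - median f t Q₀| * w x ≤
      deviationConst s t N * ∫⁻ x, sharpMaximal s Q₀ f x ^ δ * hlMaximal g x := by
  obtain ⟨a, ℓ, hℓ, hQa⟩ := hQ₀
  have hi : gridIndex a ℓ 0 a = 0 := by ext j; simp [gridIndex]
  have hcube : gridCube a ℓ 0 (gridIndex a ℓ 0 a) = Q₀ := by rw [hi, gridCube_zero_zero, hQa]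
  have hae : gridCell a ℓ 0 (gridIndex a ℓ 0 a) =ᵐ[volume] Q₀ := by
    rw [← hcube]; exact gridCell_ae_eq_gridCube hℓ _ _
  rw [← Measure.restrict_congr_set hae]
  have hmeas : ∀ k, AEMeasurable
      (fun x => ENNReal.ofReal |gridMedian f t a ℓ k x - median f t Q₀|)
      (volume.restrict (gridCell a ℓ 0 (gridIndex a ℓ 0 a))) := fun k =>
    ((measurable_gridMedian hℓ k).sub_const _).abs.ennreal_ofReal.aemeasurable
  refine lintegral_mul_le_of_tendsto hmeas hw.restrict ?_ fun k => ?_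
  · refine ae_restrict_of_ae ?_
    filter_upwards [ae_tendsto_gridMedian (a := a) hℓ hf (by linarith : 0 < t) (by linarith)]
      with x hx
    exact ENNReal.tendsto_ofReal (hx.sub_const _).abs
  -- The final generation is k and the starting one is 0, whose median is that of `Q₀`; the extra
  -- error term is dropped.
  · have h := lintegral_gridDeviation_mul_le (U := Q₀) hℓ hf hs ht hst hN hNs hw hδ hδ1 hg k k 0
      (zero_add k) a hcube.le
    refine le_trans (setLIntegral_mono' (measurableSet_gridCell hℓ _ _) fun x hx => ?_)
      (h.trans (mul_le_mul_right (setLIntegral_le_lintegral _ _) _))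
    gcongr
    have hm : gridMedian f t a ℓ 0 x = median f t Q₀ := by
      rw [gridMedian_congr hx, gridMedian, hcube]
    rw [gridDeviation, hm]
    exact le_self_add

lemma lintegral_abs_sub_median_mul_le {Q₀ : Set (Fin n → ℝ)} (hQ₀ : IsCube Q₀)
    (hf : AEMeasurable f (volume.restrict Q₀)) (hs : 0 < s) (ht : 1 / 2 ≤ t) (hst : t < 1 - s)
    {N : ℕ} (hN : 0 < N) (hNs : s * (1 + 1 / (N : ℝ)) ^ n < 1 - t) {w : (Fin n → ℝ) → ℝ≥0∞}
    (hw : AEMeasurable w volume) {δ : ℝ} (hδ : 0 < δ) (hδ1 : δ ≤ 1) :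
    ∫⁻ x in Q₀, ENNReal.ofReal |f x - median f t Q₀| * w x ≤
      deviationConst s t N * ∫⁻ x, sharpMaximal s Q₀ f x ^ δ *
        hlMaximal (Q₀.indicator fun y => sharpMaximal s Q₀ f y ^ (1 - δ) * w y) x := by
  -- Both sides are unchanged when f is replaced by a Borel representative on `Q₀`.
  rw [sharpMaximal_congr hf.ae_eq_mk, median_congr hQ₀ hf.ae_eq_mk]
  refine le_of_eq_of_le (lintegral_congr_ae ?_)
    (lintegral_abs_sub_median_mul_le_of_measurable hQ₀ hf.measurable_mk hs ht hst hN hNs hw hδ hδ1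
      fun y hy => by rw [Set.indicator_of_mem hy])
  filter_upwards [hf.ae_eq_mk] with x hx
  rw [hx]

/-- Part (i) on each `Q k` has a right side bounded by the global one, as the sharp maximal function
grows with its domain. Since each point is eventually in `Q k` and the medians tend to 0, the left
integrands converge to |f|. -/
lemma lintegral_abs_mul_le (hf : AEMeasurable f volume) (hs : 0 < s) (ht : 1 / 2 ≤ t)
    (hst : t < 1 - s) {N : ℕ} (hN : 0 < N) (hNs : s * (1 + 1 / (N : ℝ)) ^ n < 1 - t)
    {w : (Fin n → ℝ) → ℝ≥0∞} (hw : AEMeasurable w volume) {δ : ℝ} (hδ : 0 < δ) (hδ1 : δ ≤ 1)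
    {Q : ℕ → Set (Fin n → ℝ)} (hQ : ∀ k, IsCube (Q k)) (hQx : ∀ x, ∀ᶠ k in atTop, x ∈ Q k)
    (hlim : Tendsto (fun k => median f t (Q k)) atTop (𝓝 0)) :
    ∫⁻ x, ENNReal.ofReal |f x| * w x ≤
      deviationConst s t N * ∫⁻ x, sharpMaximal s Set.univ f x ^ δ *
        hlMaximal (fun y => sharpMaximal s Set.univ f y ^ (1 - δ) * w y) x := by
  refine lintegral_mul_le_of_tendsto
    (u := fun k => (Q k).indicator fun x => ENNReal.ofReal |f x - median f t (Q k)|)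
    (fun k => (hf.sub_const _).abs.ennreal_ofReal.indicator (hQ k).measurableSet) hw
    (Eventually.of_forall fun x => ?_) fun k => ?_
  · have h : Tendsto (fun k => ENNReal.ofReal |f x - median f t (Q k)|) atTop
        (𝓝 (ENNReal.ofReal |f x|)) := by
      have := ENNReal.tendsto_ofReal (hlim.const_sub (f x)).abs
      rwa [sub_zero] at this
    refine h.congr' ?_
    filter_upwards [hQx x] with k hk
    rw [Set.indicator_of_mem hk]
  · have h := lintegral_abs_sub_median_mul_le (hQ k) hf.restrict hs ht hst hN hNs hw hδ hδ1
    simp only [← Set.indicator_mul_left]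
    rw [lintegral_indicator (hQ k).measurableSet]
    refine h.trans ?_
    have hle : ∀ y, sharpMaximal s (Q k) f y ≤ sharpMaximal s Set.univ f y :=
      sharpMaximal_mono (Set.subset_univ _)
    have hδ' : 0 ≤ 1 - δ := by linarith
    gcongr with x
    · exact hle x
    · refine hlMaximal_mono (fun y => Set.indicator_apply_le' (fun _ => ?_) fun _ => zero_le) x
      gcongr
      exact hle y

lemma deviationConst_ne_top (hst : t < 1 - s) (hs : 0 < s) {N : ℕ} : deviationConst s t N ≠ ⊤ := by
  refine ENNReal.mul_ne_top (by finiteness) (ENNReal.inv_ne_top.2 ?_)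
  have : s / (1 - t) < 1 := by
    rw [div_lt_one (by linarith)]
    linarith
  simpa using this

end Weighted

end MedianOsc

theorem theorem2p1 (n : ℕ) (hn : 1 ≤ n) (s t : ℝ) (hs : 0 < s) (hs' : s < 1 / 2)
    (ht : 1 / 2 ≤ t) (ht' : t < 1 - s) :
    ∃ c : ℝ≥0, ∀ (δ : ℝ), 0 < δ → δ ≤ 1 →
      ∀ (w : (Fin n → ℝ) → ℝ≥0∞), AEMeasurable w volume →
      (∀ (Q₀ : Set (Fin n → ℝ)), MedianOsc.IsCube Q₀ →
        ∀ (f : (Fin n → ℝ) → ℝ), AEMeasurable f (volume.restrict Q₀) →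
          ∫⁻ x in Q₀, ENNReal.ofReal |f x - MedianOsc.median f t Q₀| * w x ≤
            c * ∫⁻ x, (MedianOsc.sharpMaximal s Q₀ f x) ^ δ *
              MedianOsc.hlMaximal
                (Q₀.indicator fun y => (MedianOsc.sharpMaximal s Q₀ f y) ^ (1 - δ) * w y) x) ∧
      (∀ (f : (Fin n → ℝ) → ℝ), AEMeasurable f volume →
        ∀ (Q : ℕ → Set (Fin n → ℝ)), (∀ k, MedianOsc.IsCube (Q k)) →
          (∀ x, ∀ᶠ k in atTop, x ∈ Q k) →
          Tendsto (fun k => MedianOsc.median f t (Q k)) atTop (𝓝 0) →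
          ∫⁻ x, ENNReal.ofReal |f x| * w x ≤
            c * ∫⁻ x, (MedianOsc.sharpMaximal s Set.univ f x) ^ δ *
              MedianOsc.hlMaximal
                (fun y => (MedianOsc.sharpMaximal s Set.univ f y) ^ (1 - δ) * w y) x) := by
  obtain ⟨N, hN, hNs⟩ := MedianOsc.exists_chain_length n ht'
  refine ⟨(MedianOsc.deviationConst s t N).toNNReal, fun δ hδ hδ1 w hw => ?_⟩
  rw [ENNReal.coe_toNNReal (MedianOsc.deviationConst_ne_top ht' hs)]
  exact ⟨fun Q₀ hQ₀ f hf =>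
      MedianOsc.lintegral_abs_sub_median_mul_le hQ₀ hf hs ht ht' hN hNs hw hδ hδ1,
    fun f hf Q hQ hQx hlim =>
      MedianOsc.lintegral_abs_mul_le hf hs ht ht' hN hNs hw hδ hδ1 hQ hQx hlim⟩
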